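/- Let $k$ be an algebraically closed field and let $A$, $B$ be commutative $k$-algebras, with $A$ reduced and $\operatorname{Spec}(A)$ connected (and non-empty). Let $\mathfrak M \subset A$ be a maximal ideal such that the structure map $k \to A/\mathfrak M$ is bijective. For a commutative $k$-algebra $C$ write $\operatorname{Nil}(C)$ for its nilradical, $A^*C^* = \{a \otimes c : a \in A^*,\ c \in C^*\} \subset (A \otimes_k C)^*$, and $1 + \mathfrak M \otimes \operatorname{Nil}(C)$ for the set of elements $1+x$ of $A \otimes_k C$ with $x$ in the $k$-span of the tensors $m \otimes c$, $m \in \mathfrak M$, $c \in \operatorname{Nil}(C)$. 1. For every finite decomposition $B = B_1 \times \cdots \times B_n$ into $k$-algebras, each $1 + \mathfrak M \otimes \operatorname{Nil}(B_i)$ is a subgroup of $(A \otimes_k B_i)^*$, and, under the identification $(A \otimes_k B)^* = \prod_i (A \otimes_k B_i)^*$, the canonical homomorphism $$\bigoplus_{i=1}^n \left[ A^*B_i^* \oplus \left(1 + \mathfrak M \otimes \operatorname{Nil}(B_i)\right) \right] \to (A \otimes_k B)^*$$ given by multiplication is injective. Denote its image, a subgroup of $(A\otimes_k B)^*$, by $\mu(B_1,\ldots,B_n)$.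 2. For every $x \in (A \otimes_k B)^*$ there is a finite decomposition $B = B_1 \times \cdots \times B_n$ into nonzero $k$-algebras such that $x \in \mu(B_1,\ldots,B_n)$. 3. If $B$ has only finitely many idempotent elements (for example, if $B$ is noetherian), then $B$ can be written as $B_1 \times \cdots \times B_n$ with each $\operatorname{Spec}(B_i)$ connected (and non-empty). For every decomposition $B = B_1 \times \cdots \times B_n$ with each $\operatorname{Spec}(B_i)$ connected (and non-empty), $\mu(B_1,\ldots,B_n) = (A \otimes_k B)^*$. 4. In particular, if $\operatorname{Spec}(B)$ is connected (and non-empty), then $(A \otimes_k B)^*$ is the direct sum of its subgroups $A^*B^*$ and $1 + \mathfrak M \otimes \operatorname{Nil}(B)$. -/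

import Mathlib

open scoped TensorProduct

universe u v w

/-- `M ⊗ Nil(B)`, viewed inside `A ⊗[k] B`: the `k`-span of the tensors `m ⊗ x` with
`m ∈ M` and `x` in the nilradical of `B`. -/
def tensorNil (k : Type*) {A : Type*} (B : Type*) [Field k] [CommRing A] [CommRing B]
    [Algebra k A] [Algebra k B] (M : Ideal A) : Submodule k (A ⊗[k] B) :=
  Submodule.map₂ (TensorProduct.mk k A B) (M.restrictScalars k)
    ((nilradical B).restrictScalars k)

theorem mul_mem_tensorNil (k : Type*) {A : Type*} (B : Type*) [Field k] [CommRing A] [CommRing B]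
    [Algebra k A] [Algebra k B] (M : Ideal A) (y : A ⊗[k] B) {x : A ⊗[k] B}
    (hx : x ∈ tensorNil k B M) : y * x ∈ tensorNil k B M := by
  induction y using TensorProduct.induction_on with
  | zero => rw [zero_mul]; exact Submodule.zero_mem _
  | add y z hy hz => rw [add_mul]; exact Submodule.add_mem _ hy hz
  | tmul a b =>
    have hle : tensorNil k B M ≤
        (tensorNil k B M).comap (LinearMap.mulLeft k (a ⊗ₜ[k] b)) := by
      refine Submodule.map₂_le.2 fun m hm n hn => ?_
      have h := Submodule.apply_mem_map₂ (TensorProduct.mk k A B)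
        (p := M.restrictScalars k) (q := (nilradical B).restrictScalars k)
        (M.mul_mem_left a hm) ((nilradical B).mul_mem_left b hn)
      simpa [tensorNil] using h
    exact hle hx

/-- The subgroup `A^* B^*` of `(A ⊗[k] B)^*`: the units `a ⊗ b` with `a` a unit of `A` and `b` a
unit of `B`. -/
def unitsMulUnits (k A B : Type*) [Field k] [CommRing A] [CommRing B]
    [Algebra k A] [Algebra k B] : Subgroup (A ⊗[k] B)ˣ :=
  (Units.map ((Algebra.TensorProduct.includeLeft : A →ₐ[k] A ⊗[k] B) : A →* A ⊗[k] B)).range ⊔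
  (Units.map ((Algebra.TensorProduct.includeRight : B →ₐ[k] A ⊗[k] B) : B →* A ⊗[k] B)).range

/-- The subgroup `1 + M ⊗ Nil(B)` of `(A ⊗[k] B)^*`. -/
def oneAddTensorNil (k : Type*) {A : Type*} (B : Type*) [Field k] [CommRing A] [CommRing B]
    [Algebra k A] [Algebra k B] (M : Ideal A) : Subgroup (A ⊗[k] B)ˣ where
  carrier := {u | (u : A ⊗[k] B) - 1 ∈ tensorNil k B M}
  one_mem' := by simp
  mul_mem' := by
    intro u v hu hv
    have h : ((u * v : (A ⊗[k] B)ˣ) : A ⊗[k] B) - 1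
        = (u : A ⊗[k] B) * ((v : A ⊗[k] B) - 1) + ((u : A ⊗[k] B) - 1) := by
      push_cast; ring
    simp only [Set.mem_ofPred_eq] at hu hv ⊢
    rw [h]
    exact Submodule.add_mem _ (mul_mem_tensorNil k B M _ hv) hu
  inv_mem' := by
    intro u hu
    have h : ((u⁻¹ : (A ⊗[k] B)ˣ) : A ⊗[k] B) - 1
        = -((u⁻¹ : (A ⊗[k] B)ˣ) : A ⊗[k] B) * ((u : A ⊗[k] B) - 1) := by
      rw [mul_sub, neg_mul, Units.inv_mul]; ring
    simp only [Set.mem_ofPred_eq] at hu ⊢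
    rw [h]
    exact mul_mem_tensorNil k B M _ hu

/-- The canonical homomorphism from the direct sum `A^*B^* ⊕ (1 + M ⊗ Nil(B))` to
`(A ⊗[k] B)^*`, sending `(s, t)` to `s * t`. -/
def summandHom (k : Type*) {A : Type*} (B : Type*) [Field k] [CommRing A] [CommRing B]
    [Algebra k A] [Algebra k B] (M : Ideal A) :
    unitsMulUnits k A B × oneAddTensorNil k B M →* (A ⊗[k] B)ˣ :=
  (unitsMulUnits k A B).subtype.coprod (oneAddTensorNil k B M).subtype

/-- For a decomposition `e : B ≃ C₁ × ⋯ × Cₙ`, the induced identification of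
`(A ⊗[k] B)^*` with `(A ⊗[k] C₁)^* × ⋯ × (A ⊗[k] Cₙ)^*`. -/
noncomputable def unitsTensorPi {k : Type*} (A : Type*) {B : Type*} [Field k] [CommRing A]
    [CommRing B] [Algebra k A] [Algebra k B] {n : ℕ} {C : Fin n → Type*}
    [∀ i, CommRing (C i)] [∀ i, Algebra k (C i)] (e : B ≃ₐ[k] ∀ i, C i) :
    (A ⊗[k] B)ˣ ≃* ∀ i, (A ⊗[k] C i)ˣ :=
  (Units.mapEquiv
    ((Algebra.TensorProduct.congr (AlgEquiv.refl : A ≃ₐ[k] A) e).trans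
      (Algebra.TensorProduct.piRight k k A C)).toMulEquiv).trans MulEquiv.piUnits

/-- For a decomposition `e : B ≃ C₁ × ⋯ × Cₙ`, the canonical homomorphism from
`⊕ᵢ [A^*Cᵢ^* ⊕ (1 + M ⊗ Nil(Cᵢ))]` to `(A ⊗[k] B)^*`. -/
noncomputable def muHom {k A B : Type*} [Field k] [CommRing A]
    [CommRing B] [Algebra k A] [Algebra k B] (M : Ideal A) {n : ℕ} {C : Fin n → Type*}
    [∀ i, CommRing (C i)] [∀ i, Algebra k (C i)] (e : B ≃ₐ[k] ∀ i, C i) :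
    (∀ i, unitsMulUnits k A (C i) × oneAddTensorNil k (C i) M) →* (A ⊗[k] B)ˣ :=
  (unitsTensorPi A e).symm.toMonoidHom.comp
    (MonoidHom.pi fun i => (summandHom k (C i) M).comp (Pi.evalMonoidHom _ i))

/-- The subgroup `μ(C₁, …, Cₙ)` of `(A ⊗[k] B)^*` attached to a decomposition
`e : B ≃ C₁ × ⋯ × Cₙ`. -/
noncomputable def muSubgroup {k A B : Type*} [Field k] [CommRing A]
    [CommRing B] [Algebra k A] [Algebra k B] (M : Ideal A) {n : ℕ} {C : Fin n → Type*}
    [∀ i, CommRing (C i)] [∀ i, Algebra k (C i)] (e : B ≃ₐ[k] ∀ i, C i) :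
    Subgroup (A ⊗[k] B)ˣ :=
  (muHom M e).range

/-! The heart is that a unit `v` of `A ⊗ B` is a pure tensor when both algebras are reduced,
connected and of finite type. For domains, apply functionals of `A` to `v` and measure the results
with a valuation of `B` trivial on `k`. The maximum value is attained at a general point of `Spec
A`; comparing `v` with `v⁻¹` shows that it is attained at every point. So the ratio of any slice to
the slice at a fixed point lies in every valuation ring of `Frac B` containing `k`, hence in `k`,
and `v = a ⊗ c` (`exists_eq_tmul_of_isDomain`). Reduced connected algebras follow by gluing over
irreducible components, in one factor and then in the other (`exists_eq_tmul_of_forall_prime`).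

If `B` is not reduced, working modulo its nilradical leaves a factor in `1 + A ⊗ Nil(B)`. The
splitting `A = k ⊕ M` moves its constant part into `B^*` and leaves `1 + M ⊗ Nil(B)`. General `A`
and `B` reduce to finite type because a unit and its inverse involve finitely many elements; the
primitive idempotents of the resulting noetherian subalgebra of `B` give the decomposition.
Injectivity is checked by evaluating at `M` and then applying a functional that kills `Nil(B)`. -/

/-! ### Contracting tensors with linear functionals. -/

section Slices

variable {k V W : Type*} [Field k] [AddCommGroup V] [AddCommGroup W] [Module k V] [Module k W]

/-- Contraction of the left tensor factor with a linear functional. -/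
noncomputable def sliceLeft (φ : V →ₗ[k] k) : V ⊗[k] W →ₗ[k] W :=
  (TensorProduct.lid k W).toLinearMap ∘ₗ φ.rTensor W

/-- Contraction of the right tensor factor with a linear functional. -/
noncomputable def sliceRight (ψ : W →ₗ[k] k) : V ⊗[k] W →ₗ[k] V :=
  (TensorProduct.rid k V).toLinearMap ∘ₗ ψ.lTensor V

@[simp]
theorem sliceLeft_tmul (φ : V →ₗ[k] k) (v : V) (w : W) : sliceLeft φ (v ⊗ₜ[k] w) = φ v • w := by
  simp [sliceLeft]

@[simp]
theorem sliceRight_tmul (ψ : W →ₗ[k] k) (v : V) (w : W) :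
    sliceRight ψ (v ⊗ₜ[k] w) = ψ w • v := by
  simp [sliceRight]

theorem apply_sliceRight (φ : V →ₗ[k] k) (ψ : W →ₗ[k] k) (z : V ⊗[k] W) :
    φ (sliceRight ψ z) = ψ (sliceLeft φ z) := by
  induction z using TensorProduct.induction_on with
  | zero => simp
  | add y z hy hz => simp [hy, hz]
  | tmul a b => simp [mul_comm]

theorem eq_zero_of_sliceLeft_eq_zero {z : V ⊗[k] W} (h : ∀ φ : V →ₗ[k] k, sliceLeft φ z = 0) :
    z = 0 := by
  classical
  let b := Module.Basis.ofVectorSpace k V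
  refine (TensorProduct.equivFinsuppOfBasisLeft b).injective ?_
  ext i
  rw [TensorProduct.equivFinsuppOfBasisLeft_apply, map_zero]
  exact h (b.coord i)

theorem eq_zero_of_sliceRight_eq_zero {z : V ⊗[k] W} (h : ∀ ψ : W →ₗ[k] k, sliceRight ψ z = 0) :
    z = 0 := by
  refine eq_zero_of_sliceLeft_eq_zero fun φ => (Module.forall_dual_apply_eq_zero_iff k _).1 fun ψ => ?_
  rw [← apply_sliceRight, h, map_zero]

theorem exists_dual_eq_one {c : W} (hc : c ≠ 0) : ∃ ψ : W →ₗ[k] k, ψ c = 1 := by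
  obtain ⟨ψ, hψ⟩ := not_forall.1 (mt (Module.forall_dual_apply_eq_zero_iff k c).1 hc)
  exact ⟨(ψ c)⁻¹ • ψ, by simp [inv_mul_cancel₀ hψ]⟩

theorem exists_eq_tmul_of_sliceLeft {z : V ⊗[k] W} {c : W} (hc : c ≠ 0)
    (h : ∀ φ : V →ₗ[k] k, ∃ t : k, sliceLeft φ z = t • c) : ∃ a : V, z = a ⊗ₜ c := by
  obtain ⟨ψ, hψ⟩ := exists_dual_eq_one (k := k) hc
  refine ⟨sliceRight ψ z, sub_eq_zero.1 (eq_zero_of_sliceLeft_eq_zero fun φ => ?_)⟩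
  obtain ⟨t, ht⟩ := h φ
  rw [map_sub, sliceLeft_tmul, apply_sliceRight, ht]
  simp [hψ]

/-- With `χ c = 1`, each `ψ` differs from `ψ c • χ` by a functional killing `c`, so only the
`χ`-slice matters. -/
theorem exists_eq_tmul_of_sliceRight {z : V ⊗[k] W} {c : W} (hc : c ≠ 0)
    (h : ∀ ψ : W →ₗ[k] k, ψ c = 0 → sliceRight ψ z = 0) : ∃ a : V, z = a ⊗ₜ c := by
  obtain ⟨χ, hχ⟩ := exists_dual_eq_one (k := k) hc
  refine ⟨sliceRight χ z, sub_eq_zero.1 (eq_zero_of_sliceRight_eq_zero fun ψ => ?_)⟩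
  have h1 := h (ψ - ψ c • χ) (by simp [hχ])
  have h2 : sliceRight (ψ - ψ c • χ) z = sliceRight ψ z - ψ c • sliceRight χ z := by
    simp [sliceRight, LinearMap.lTensor_sub, LinearMap.lTensor_smul]
  rw [map_sub, sliceRight_tmul, ← h2, h1]

end Slices

/-! ### Valuations, and units over two domains. -/

section Algebra

variable {k A B : Type*} [Field k] [CommRing A] [CommRing B] [Algebra k A] [Algebra k B]

theorem sliceLeft_algHom_mul (x : A →ₐ[k] k) (y z : A ⊗[k] B) :
    sliceLeft x.toLinearMap (y * z) = sliceLeft x.toLinearMap y * sliceLeft x.toLinearMap z := by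
  induction y using TensorProduct.induction_on with
  | zero => simp
  | add y y' hy hy' => simp [add_mul, hy, hy']
  | tmul a b =>
    induction z using TensorProduct.induction_on with
    | zero => simp
    | add z z' hz hz' => simp [mul_add, hz, hz']
    | tmul a' b' => simp [mul_smul_mul_comm]

theorem sliceLeft_algHom_one (x : A →ₐ[k] k) :
    sliceLeft x.toLinearMap (1 : A ⊗[k] B) = 1 := by
  simp [Algebra.TensorProduct.one_def]

theorem sliceLeft_mul_sliceLeft_inv (x : A →ₐ[k] k) (v : (A ⊗[k] B)ˣ) :
    sliceLeft x.toLinearMap (v : A ⊗[k] B) *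
      sliceLeft x.toLinearMap ((v⁻¹ : (A ⊗[k] B)ˣ) : A ⊗[k] B) = 1 := by
  rw [← sliceLeft_algHom_mul, Units.mul_inv, sliceLeft_algHom_one]

/-- The functional slices of a tensor have bounded valuation, and the bound is attained at
every point outside a proper closed subset. -/
theorem exists_valuation_sliceLeft_bound [Nontrivial A] {Γ : Type*}
    [LinearOrderedCommGroupWithZero Γ] (val : Valuation B Γ)
    (hval : ∀ c : k, c ≠ 0 → val (algebraMap k B c) = 1) (z : A ⊗[k] B) :
    ∃ w : Γ, (∀ φ : A →ₗ[k] k, val (sliceLeft φ z) ≤ w) ∧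
      ∃ h : A, h ≠ 0 ∧ ∀ x : A →ₐ[k] k, x h ≠ 0 → w ≤ val (sliceLeft x.toLinearMap z) := by
  classical
  have hle (c : k) : val (algebraMap k B c) ≤ 1 := by
    rcases eq_or_ne c 0 with rfl | hc
    · simp
    · exact (hval c hc).le
  let b := Module.Basis.ofVectorSpace k A
  obtain ⟨n, rfl⟩ := TensorProduct.eq_repr_basis_left b z
  set z := n.sum fun i m => b i ⊗ₜ[k] m with hz
  have hcoord (i) : sliceLeft (b.coord i) z = n i := by
    have h1 := TensorProduct.equivFinsuppOfBasisLeft_apply b z i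
    have h2 : (TensorProduct.equivFinsuppOfBasisLeft b).symm n = z := by
      rw [TensorProduct.equivFinsuppOfBasisLeft_symm_apply]
    rw [← h2, LinearEquiv.apply_symm_apply, h2] at h1
    exact h1.symm
  have hle' (φ : A →ₗ[k] k) : val (sliceLeft φ z) ≤ n.support.sup fun i => val (n i) := by
    rw [hz, Finsupp.sum, map_sum]
    refine Valuation.map_sum_le val fun i hi => ?_
    rw [sliceLeft_tmul, Algebra.smul_def, map_mul]
    exact (mul_le_of_le_one_left' (hle _)).trans (Finset.le_sup (f := fun i => val (n i)) hi)
  refine ⟨_, hle', ?_⟩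
  set w := n.support.sup fun i => val (n i) with hw
  rcases eq_or_ne w 0 with h0 | h0
  · exact ⟨1, one_ne_zero, fun x _ => by rw [h0]; exact zero_le⟩
  have hne : n.support.Nonempty := by
    rw [Finset.nonempty_iff_ne_empty]
    intro h
    exact h0 (by rw [hw, h, Finset.sup_empty, bot_eq_zero])
  obtain ⟨j, -, hj⟩ := Finset.exists_mem_eq_sup _ hne fun i => val (n i)
  -- A functional `ψ` killing `S` but not the dominant coefficient `n j` yields `h = sliceRight ψ
  -- z`. Since `x h` is `ψ` of the slice at `x`, its nonvanishing keeps that slice out of `S`.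
  let S : Submodule k B :=
    { carrier := {y | val y < w}
      add_mem' := fun ha hb => Valuation.map_add_lt val ha hb
      zero_mem' := by simpa using zero_lt_iff.2 h0
      smul_mem' := fun c y hy => by
        simp only [Set.mem_ofPred_eq] at hy ⊢
        rw [Algebra.smul_def, map_mul]
        exact (mul_le_of_le_one_left' (hle c)).trans_lt hy }
  have hjS : n j ∉ S := by
    change ¬ val (n j) < w
    rw [hw, hj]
    exact lt_irrefl _
  obtain ⟨ψ, hψ, hψS⟩ := Submodule.exists_le_ker_of_notMem hjS
  refine ⟨sliceRight ψ z, fun h => hψ ?_, fun x hx => ?_⟩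
  · rw [← hcoord j, ← apply_sliceRight, h, map_zero]
  · by_contra hlt
    refine hx ?_
    have := apply_sliceRight x.toLinearMap ψ z
    rw [AlgHom.toLinearMap_apply] at this
    rw [this]
    exact hψS (not_le.1 hlt)

variable [IsAlgClosed k]

/-- Nullstellensatz: a maximal ideal of the localization `A_h`, which is nonzero and of finite type,
has residue field `k`. -/
theorem exists_algHom_apply_ne_zero [Algebra.FiniteType k A] {h : A} (hh : ¬ IsNilpotent h) :
    ∃ x : A →ₐ[k] k, x h ≠ 0 := by
  have : Nontrivial (Localization.Away h) := by
    rw [← not_subsingleton_iff_nontrivial]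
    intro hs
    refine hh ?_
    obtain ⟨⟨_, n, rfl⟩, hn⟩ := (IsLocalization.map_eq_zero_iff (Submonoid.powers h)
      (Localization.Away h) (1 : A)).1 (Subsingleton.elim _ _)
    exact ⟨n, by simpa using hn⟩
  have : Algebra.FinitePresentation A (Localization.Away h) :=
    IsLocalization.Away.finitePresentation h
  have : Algebra.FiniteType k (Localization.Away h) :=
    Algebra.FiniteType.trans (S := A) inferInstance inferInstance
  obtain ⟨m, hm⟩ := Ideal.exists_maximal (Localization.Away h)
  let := Ideal.Quotient.field m
  have := finite_of_finite_type_of_isJacobsonRing k (Localization.Away h ⧸ m)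
  let e := AlgEquiv.ofBijective (Algebra.ofId k (Localization.Away h ⧸ m))
    (IsAlgClosed.algebraMap_bijective_of_isIntegral (k := k))
  let f : A →ₐ[k] Localization.Away h ⧸ m :=
    (Ideal.Quotient.mkₐ k m).comp (IsScalarTower.toAlgHom k A (Localization.Away h))
  refine ⟨e.symm.toAlgHom.comp f, ?_⟩
  have hu : IsUnit (f h) := by
    have := (IsLocalization.Away.algebraMap_isUnit (S := Localization.Away h) h)
    exact this.map (Ideal.Quotient.mkₐ k m)
  exact (hu.map e.symm.toAlgHom).ne_zero

/-- Let `w`, `w'` bound the slices of `v`, `v⁻¹`. At a point where both bounds are attained the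
slices are mutually inverse, so `w * w' ≤ 1`. At `ε` they are again inverse and bounded by `w`,
`w'`, which forces the slice of `v` to have value at least `w`. -/
theorem valuation_sliceLeft_le [IsDomain A] [Algebra.FiniteType k A] {Γ : Type*}
    [LinearOrderedCommGroupWithZero Γ] (val : Valuation B Γ)
    (hval : ∀ c : k, c ≠ 0 → val (algebraMap k B c) = 1) (v : (A ⊗[k] B)ˣ) (ε : A →ₐ[k] k)
    (φ : A →ₗ[k] k) :
    val (sliceLeft φ (v : A ⊗[k] B)) ≤ val (sliceLeft ε.toLinearMap (v : A ⊗[k] B)) := by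
  obtain ⟨w, hw, h, hh, hx⟩ := exists_valuation_sliceLeft_bound val hval (v : A ⊗[k] B)
  obtain ⟨w', hw', h', hh', hx'⟩ :=
    exists_valuation_sliceLeft_bound val hval ((v⁻¹ : (A ⊗[k] B)ˣ) : A ⊗[k] B)
  obtain ⟨x, hxx⟩ := exists_algHom_apply_ne_zero (k := k) (h := h * h')
    (by simpa [isNilpotent_iff_eq_zero] using ⟨hh, hh'⟩)
  rw [map_mul] at hxx
  have hprod (y : A →ₐ[k] k) := congrArg val (sliceLeft_mul_sliceLeft_inv y v)
  simp only [map_mul, map_one] at hprod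
  have hww : w * w' ≤ 1 :=
    (mul_le_mul' (hx x (left_ne_zero_of_mul hxx)) (hx' x (right_ne_zero_of_mul hxx))).trans
      (hprod x).le
  calc _ ≤ w := hw φ
    _ = w * (val (sliceLeft ε.toLinearMap (v : A ⊗[k] B)) *
          val (sliceLeft ε.toLinearMap ((v⁻¹ : (A ⊗[k] B)ˣ) : A ⊗[k] B))) := by
        rw [hprod, mul_one]
    _ ≤ w * (val (sliceLeft ε.toLinearMap (v : A ⊗[k] B)) * w') := by
        gcongr; exact hw' _
    _ = (w * w') * val (sliceLeft ε.toLinearMap (v : A ⊗[k] B)) := by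
        rw [mul_comm _ w', mul_assoc]
    _ ≤ _ := mul_le_of_le_one_left' hww

/-- The image of `k` is integrally closed in `F` because `k` is algebraically closed, and an
integrally closed subring is the intersection of the valuation rings containing it. -/
theorem exists_algebraMap_eq_of_forall_valuationSubring {F : Type*} [Field F] [Algebra k F] {y : F}
    (h : ∀ O : ValuationSubring F, (∀ c : k, algebraMap k F c ∈ O) → y ∈ O) :
    ∃ c : k, algebraMap k F c = y := by
  by_contra hy
  have hy' : y ∉ (algebraMap k F).range := hy
  have : IsIntegrallyClosedIn (algebraMap k F).range F := by
    rw [Subring.isIntegrallyClosedIn_iff]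
    intro x hx
    have hx' : IsIntegral k x := by
      obtain ⟨p, hp, hpx⟩ := hx
      obtain ⟨q, hq, -, hqm⟩ := Polynomial.lifts_and_natDegree_eq_and_monic
        (f := (algebraMap k F).rangeRestrict) (p := p)
        ((Polynomial.lifts_iff_coeff_lifts p).2 fun n =>
          (algebraMap k F).rangeRestrict_surjective _) hp
      refine ⟨q, hqm, ?_⟩
      rw [← hq, Polynomial.eval₂_map] at hpx
      exact hpx
    have : Algebra.IsIntegral k (Algebra.adjoin k {x}) := Algebra.IsIntegral.adjoin (by simpa)
    obtain ⟨c, hc⟩ := (IsAlgClosed.algebraMap_bijective_of_isIntegral (k := k)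
      (K := Algebra.adjoin k {x})).2 ⟨x, Algebra.self_mem_adjoin_singleton k x⟩
    exact ⟨c, congrArg Subtype.val hc⟩
  obtain ⟨O, hO, hyO⟩ := Subring.exists_le_valuationSubring_of_isIntegrallyClosedIn hy'
  exact hyO (h O fun c => hO ⟨c, rfl⟩)

/-- Units of a tensor product of two domains over an algebraically closed field are pure tensors. -/
theorem exists_eq_tmul_of_isDomain [IsDomain A] [Algebra.FiniteType k A] [IsDomain B]
    (v : (A ⊗[k] B)ˣ) : ∃ (a : A) (c : Bˣ), (v : A ⊗[k] B) = a ⊗ₜ (c : B) := by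
  -- Any `k`-point serves as reference: evaluation there is multiplicative, so the slice `c` is a
  -- unit.
  obtain ⟨ε, -⟩ := exists_algHom_apply_ne_zero (k := k) (A := A) (h := 1) (by simp)
  let c : Bˣ := Units.mkOfMulEqOne _ _ (sliceLeft_mul_sliceLeft_inv ε v)
  suffices ∃ a : A, (v : A ⊗[k] B) = a ⊗ₜ (c : B) from
    let ⟨a, ha⟩ := this; ⟨a, c, ha⟩
  refine exists_eq_tmul_of_sliceLeft c.ne_zero fun φ => ?_
  let F := FractionRing B
  have hc0 : algebraMap B F c ≠ 0 := (c.isUnit.map _).ne_zero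
  obtain ⟨t, ht⟩ := exists_algebraMap_eq_of_forall_valuationSubring (k := k)
    (y := algebraMap B F (sliceLeft φ (v : A ⊗[k] B)) / algebraMap B F c) fun O hO => by
      have hval (t : k) (ht : t ≠ 0) : O.valuation.comap (algebraMap B F) (algebraMap k B t) = 1 := by
        rw [Valuation.comap_apply, ← IsScalarTower.algebraMap_apply]
        refine le_antisymm ((O.valuation_le_one_iff _).2 (hO t)) ?_
        have h1 := (O.valuation_le_one_iff _).2 (hO t⁻¹)
        rw [map_inv₀, map_inv₀] at h1
        exact (inv_le_one₀ (zero_lt_iff.2 (by simpa using ht))).1 h1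
      rw [← O.valuation_le_one_iff, map_div₀]
      refine div_le_one_of_le₀ ?_ zero_le
      exact valuation_sliceLeft_le (O.valuation.comap (algebraMap B F)) hval v ε φ
  refine ⟨t, FaithfulSMul.algebraMap_injective B F ?_⟩
  rw [eq_div_iff hc0] at ht
  rw [← ht, Algebra.smul_def, map_mul, ← IsScalarTower.algebraMap_apply]

end Algebra

/-! ### Gluing pure tensors over irreducible components. -/

section Gluing

theorem sliceRight_map {k V V' W : Type*} [Field k] [AddCommGroup V] [AddCommGroup V']
    [AddCommGroup W] [Module k V] [Module k V'] [Module k W] (f : V →ₗ[k] V') (ψ : W →ₗ[k] k)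
    (z : V ⊗[k] W) :
    sliceRight ψ (TensorProduct.map f LinearMap.id z) = f (sliceRight ψ z) := by
  induction z using TensorProduct.induction_on with
  | zero => simp
  | add y z hy hz => simp [hy, hz]
  | tmul a b => simp

variable {k A B : Type*} [Field k] [CommRing A] [CommRing B] [Algebra k A] [Algebra k B]

/-- The primes `p` of `A` such that the image of `z` in `(A ⧸ p) ⊗ B` is of the form `a ⊗ c`. -/
def tmulLocus (z : A ⊗[k] B) (c : B) : Set (PrimeSpectrum A) :=
  PrimeSpectrum.zeroLocus {a | ∃ ψ : B →ₗ[k] k, ψ c = 0 ∧ sliceRight ψ z = a}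

theorem mem_tmulLocus {z : A ⊗[k] B} {c : B} {p : PrimeSpectrum A} :
    p ∈ tmulLocus z c ↔ ∀ ψ : B →ₗ[k] k, ψ c = 0 → sliceRight ψ z ∈ p.asIdeal := by
  simp only [tmulLocus, PrimeSpectrum.mem_zeroLocus, Set.subset_def, Set.mem_ofPred_eq,
    SetLike.mem_coe]
  exact ⟨fun h ψ hψ => h _ ⟨ψ, hψ, rfl⟩, fun h a ⟨ψ, hψ, ha⟩ => ha ▸ h ψ hψ⟩

/-- If `c` were not a multiple of `d`, every functional would be a sum of one killing `c` and one
killing `d`. At a common prime `q` all slices would then vanish, so the unit `v` would become zero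
in the nonzero ring `(A ⧸ q) ⊗ B`. Hence two loci are equal or disjoint when the roles of `c` and
`d` are exchanged as well. -/
theorem tmulLocus_subset_of_nonempty_inter [Nontrivial B] (v : (A ⊗[k] B)ˣ) {c d : B}
    (h : (tmulLocus (v : A ⊗[k] B) c ∩ tmulLocus (v : A ⊗[k] B) d).Nonempty) :
    tmulLocus (v : A ⊗[k] B) c ⊆ tmulLocus (v : A ⊗[k] B) d := by
  obtain ⟨q, hqc, hqd⟩ := h
  rw [mem_tmulLocus] at hqc hqd
  suffices hc : c ∈ Submodule.span k {d} by
    obtain ⟨t, rfl⟩ := Submodule.mem_span_singleton.1 hc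
    intro p hp
    rw [mem_tmulLocus] at hp ⊢
    exact fun ψ hψ => hp ψ (by simp [hψ])
  by_contra hc
  obtain ⟨χ, hχ, hχd⟩ := Submodule.exists_le_ker_of_notMem hc
  have hχd' : χ d = 0 := hχd (Submodule.mem_span_singleton_self d)
  have hall (ψ : B →ₗ[k] k) : sliceRight ψ (v : A ⊗[k] B) ∈ q.asIdeal := by
    have h1 := hqc (ψ - (ψ c / χ c) • χ) (by simp [div_mul_cancel₀ _ hχ])
    have h2 := hqd ((ψ c / χ c) • χ) (by simp [hχd'])
    have h3 : sliceRight ψ (v : A ⊗[k] B) = sliceRight (ψ - (ψ c / χ c) • χ) (v : A ⊗[k] B) +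
        sliceRight ((ψ c / χ c) • χ) (v : A ⊗[k] B) := by
      simp [sliceRight, LinearMap.lTensor_sub]
    rw [h3]
    exact q.asIdeal.add_mem h1 h2
  let π : A ⊗[k] B →ₐ[k] (A ⧸ q.asIdeal) ⊗[k] B :=
    Algebra.TensorProduct.map (Ideal.Quotient.mkₐ k q.asIdeal) (AlgHom.id k B)
  have h0 : π (v : A ⊗[k] B) = 0 := by
    refine eq_zero_of_sliceRight_eq_zero fun ψ => ?_
    refine (sliceRight_map (Ideal.Quotient.mkₐ k q.asIdeal).toLinearMap ψ (v : A ⊗[k] B)).trans ?_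
    exact Ideal.Quotient.eq_zero_iff_mem.2 (hall ψ)
  have hu : IsUnit (π (v : A ⊗[k] B)) := v.isUnit.map π
  exact hu.ne_zero h0

/-- A unit of `A ⊗ B` with `A` reduced and connected is a pure tensor as soon as this holds over
all irreducible components of `A`. -/
theorem exists_eq_tmul_of_forall_prime [IsNoetherianRing A] [IsReduced A]
    [ConnectedSpace (PrimeSpectrum A)] [Nontrivial B] (v : (A ⊗[k] B)ˣ)
    (H : ∀ p : Ideal A, p.IsPrime → ∃ (a : A ⧸ p) (c : Bˣ),
      Algebra.TensorProduct.map (Ideal.Quotient.mkₐ k p) (AlgHom.id k B) (v : A ⊗[k] B) =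
        a ⊗ₜ (c : B)) :
    ∃ (a : A) (c : Bˣ), (v : A ⊗[k] B) = a ⊗ₜ (c : B) := by
  have hmem (p : PrimeSpectrum A) : ∃ c : Bˣ, p ∈ tmulLocus (v : A ⊗[k] B) (c : B) := by
    obtain ⟨a, c, hac⟩ := H p.asIdeal p.2
    refine ⟨c, mem_tmulLocus.2 fun ψ hψ => Ideal.Quotient.eq_zero_iff_mem.1 ?_⟩
    refine (sliceRight_map (Ideal.Quotient.mkₐ k p.asIdeal).toLinearMap ψ
      (v : A ⊗[k] B)).symm.trans ?_
    exact (congrArg (sliceRight ψ) hac).trans (by simp [hψ])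
  choose c hc using hmem
  set Z : PrimeSpectrum A → Set (PrimeSpectrum A) := fun p => tmulLocus (v : A ⊗[k] B) (c p) with hZ
  have hclosed (p) : IsClosed (Z p) := PrimeSpectrum.isClosed_zeroLocus _
  have hfin : {p : PrimeSpectrum A | p.asIdeal ∈ minimalPrimes A}.Finite :=
    (minimalPrimes.finite_of_isNoetherianRing A).preimage
      (fun p _ q _ h => PrimeSpectrum.ext h)
  have hcover (q : PrimeSpectrum A) : ∃ p : PrimeSpectrum A, p.asIdeal ∈ minimalPrimes A ∧
      q ∈ Z p := by
    obtain ⟨p, hp, hpq⟩ := Ideal.exists_minimalPrimes_le (I := ⊥) (J := q.asIdeal) bot_le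
    refine ⟨⟨p, hp.1.1⟩, hp, mem_tmulLocus.2 fun ψ hψ => hpq ?_⟩
    exact mem_tmulLocus.1 (hc ⟨p, hp.1.1⟩) ψ hψ
  obtain ⟨p₀⟩ : Nonempty (PrimeSpectrum A) := inferInstance
  -- The loci of the minimal primes cover the spectrum, and a locus meeting `Z p₀` lies inside it.
  -- So the complement is a finite union of closed loci and `Z p₀` is clopen.
  have hcompl : (Z p₀)ᶜ = ⋃ p ∈ {p : PrimeSpectrum A | p.asIdeal ∈ minimalPrimes A} ∩
      {p | Disjoint (Z p) (Z p₀)}, Z p := by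
    ext q
    simp only [Set.mem_compl_iff, Set.mem_iUnion, exists_prop]
    constructor
    · intro hq
      obtain ⟨p, hp, hqp⟩ := hcover q
      refine ⟨p, ⟨hp, Set.disjoint_iff_inter_eq_empty.2 ?_⟩, hqp⟩
      by_contra hne
      exact hq (tmulLocus_subset_of_nonempty_inter v (Set.nonempty_iff_ne_empty.2 hne) hqp)
    · rintro ⟨p, ⟨-, hp⟩, hqp⟩ hq
      exact Set.disjoint_left.1 hp hqp hq
  have hclopen : IsClopen (Z p₀) := by
    refine ⟨hclosed p₀, isClosed_compl_iff.1 ?_⟩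
    rw [hcompl]
    exact (hfin.inter_of_left _).isClosed_biUnion fun p _ => hclosed p
  have huniv : Z p₀ = Set.univ := hclopen.eq_univ ⟨p₀, hc p₀⟩
  suffices ∃ a : A, (v : A ⊗[k] B) = a ⊗ₜ (c p₀ : B) from
    let ⟨a, ha⟩ := this; ⟨a, c p₀, ha⟩
  refine exists_eq_tmul_of_sliceRight (c p₀).ne_zero fun ψ hψ => ?_
  -- The slice lies in every prime, so it vanishes because `A` is reduced.
  have hnil : sliceRight ψ (v : A ⊗[k] B) ∈ nilradical A := by
    rw [nilradical_eq_sInf, Submodule.mem_sInf]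
    intro p hp
    exact mem_tmulLocus.1 (huniv ▸ Set.mem_univ (⟨p, hp⟩ : PrimeSpectrum A) : _ ∈ Z p₀) ψ hψ
  rwa [nilradical_eq_zero] at hnil

/-- Slicing by `ψ` with `ψ 1 = 1` is an `A`-linear retraction of `A → A ⊗ B`; it carries an inverse
of `a ⊗ 1` to an inverse of `a`. -/
theorem isUnit_of_isUnit_tmul_one [Nontrivial B] {a : A} (h : IsUnit (a ⊗ₜ[k] (1 : B))) :
    IsUnit a := by
  obtain ⟨z, hz⟩ := h.exists_right_inv
  obtain ⟨ψ, hψ⟩ := exists_dual_eq_one (k := k) (one_ne_zero (α := B))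
  refine IsUnit.of_mul_eq_one (sliceRight ψ z) ?_
  have key (y : A ⊗[k] B) : sliceRight ψ ((a ⊗ₜ[k] (1 : B)) * y) = a * sliceRight ψ y := by
    induction y using TensorProduct.induction_on with
    | zero => simp
    | add y z hy hz => simp [mul_add, hy, hz]
    | tmul a' b => simp
  rw [← key, hz, Algebra.TensorProduct.one_def, sliceRight_tmul, hψ, one_smul]

theorem exists_units_eq_tmul [Nontrivial B] {v : (A ⊗[k] B)ˣ}
    (h : ∃ (a : A) (c : Bˣ), (v : A ⊗[k] B) = a ⊗ₜ (c : B)) :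
    ∃ (a : Aˣ) (c : Bˣ), (v : A ⊗[k] B) = (a : A) ⊗ₜ (c : B) := by
  obtain ⟨a, c, hac⟩ := h
  have hu : IsUnit (a ⊗ₜ[k] (1 : B)) := by
    have h1 : a ⊗ₜ[k] (1 : B) = v * ((1 : A) ⊗ₜ[k] ((c⁻¹ : Bˣ) : B)) := by
      rw [hac]; simp
    rw [h1]
    exact v.isUnit.mul ((c⁻¹).isUnit.map (Algebra.TensorProduct.includeRight : B →ₐ[k] A ⊗[k] B))
  exact ⟨(isUnit_of_isUnit_tmul_one hu).unit, c, hac⟩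

theorem exists_units_eq_tmul_comm [Nontrivial A]
    (H : ∀ v : (B ⊗[k] A)ˣ, ∃ (b : B) (c : Aˣ), (v : B ⊗[k] A) = b ⊗ₜ (c : A))
    (v : (A ⊗[k] B)ˣ) : ∃ (a : A) (c : Bˣ), (v : A ⊗[k] B) = a ⊗ₜ (c : B) := by
  let e := Algebra.TensorProduct.comm k A B
  obtain ⟨b, a, hab⟩ := exists_units_eq_tmul (H (Units.map (e : A ⊗[k] B →* B ⊗[k] A) v))
  refine ⟨a, b, e.injective ?_⟩
  exact hab.trans (by simp [e])

variable [IsAlgClosed k]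

theorem nontrivial_of_connectedSpace_primeSpectrum (R : Type*) [CommRing R]
    [ConnectedSpace (PrimeSpectrum R)] : Nontrivial R :=
  PrimeSpectrum.nonempty_iff_nontrivial.1 inferInstance

/-- Units of a tensor product of two reduced connected algebras of finite type over an algebraically
closed field are pure tensors. -/
theorem exists_eq_tmul_of_isReduced [Algebra.FiniteType k A] [Algebra.FiniteType k B]
    [IsReduced A] [IsReduced B] [ConnectedSpace (PrimeSpectrum A)]
    [ConnectedSpace (PrimeSpectrum B)] (v : (A ⊗[k] B)ˣ) :
    ∃ (a : A) (c : Bˣ), (v : A ⊗[k] B) = a ⊗ₜ (c : B) := by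
  have := nontrivial_of_connectedSpace_primeSpectrum A
  have := nontrivial_of_connectedSpace_primeSpectrum B
  have := Algebra.FiniteType.isNoetherianRing k A
  have := Algebra.FiniteType.isNoetherianRing k B
  refine exists_eq_tmul_of_forall_prime v fun p hp => ?_
  suffices ∀ y : ((A ⧸ p) ⊗[k] B)ˣ, ∃ (a : A ⧸ p) (c : Bˣ), (y : (A ⧸ p) ⊗[k] B) = a ⊗ₜ (c : B) from
    this (Units.map (Algebra.TensorProduct.map (Ideal.Quotient.mkₐ k p) (AlgHom.id k B) :
      A ⊗[k] B →* (A ⧸ p) ⊗[k] B) v)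
  -- Exchanging the factors lets the same gluing run over the primes of `B`, with the domain `A ⧸ p`
  -- as the other factor.
  refine exists_units_eq_tmul_comm fun y => ?_
  refine exists_eq_tmul_of_forall_prime y fun q hq => ?_
  exact exists_eq_tmul_of_isDomain (Units.map
    (Algebra.TensorProduct.map (Ideal.Quotient.mkₐ k q) (AlgHom.id k (A ⧸ p)) :
      B ⊗[k] (A ⧸ p) →* (B ⧸ q) ⊗[k] (A ⧸ p)) y)

end Gluing

/-! ### Nilpotent parts and the direct sum. -/

section Factorization

variable {k A B : Type*} [Field k] [CommRing A] [CommRing B] [Algebra k A] [Algebra k B]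

/-- The coefficients of `z` along a basis of `A` are themselves slices. -/
theorem mem_tensorNil_top_of_sliceLeft {z : A ⊗[k] B}
    (h : ∀ φ : A →ₗ[k] k, sliceLeft φ z ∈ nilradical B) : z ∈ tensorNil k B (⊤ : Ideal A) := by
  classical
  let b := Module.Basis.ofVectorSpace k A
  rw [← (TensorProduct.equivFinsuppOfBasisLeft b).symm_apply_apply z,
    TensorProduct.equivFinsuppOfBasisLeft_symm_apply]
  refine Submodule.sum_mem _ fun i _ =>
    Submodule.apply_mem_map₂ (TensorProduct.mk k A B) (Submodule.mem_top) ?_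
  rw [TensorProduct.equivFinsuppOfBasisLeft_apply]
  exact h (b.coord i)

theorem sliceLeft_map {A' B' : Type*} [CommRing A'] [CommRing B'] [Algebra k A'] [Algebra k B']
    (g : B →ₐ[k] B') (φ : A →ₗ[k] k) (z : A ⊗[k] B) :
    sliceLeft φ (Algebra.TensorProduct.map (AlgHom.id k A) g z) = g (sliceLeft φ z) := by
  induction z using TensorProduct.induction_on with
  | zero => simp
  | add y z hy hz => simp [hy, hz]
  | tmul a b => simp

theorem map_mem_tensorNil_top {A' B' : Type*} [CommRing A'] [CommRing B'] [Algebra k A']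
    [Algebra k B'] (f : A →ₐ[k] A') (g : B →ₐ[k] B') {z : A ⊗[k] B}
    (hz : z ∈ tensorNil k B (⊤ : Ideal A)) :
    Algebra.TensorProduct.map f g z ∈ tensorNil k B' (⊤ : Ideal A') := by
  have hle : tensorNil k B (⊤ : Ideal A) ≤ (tensorNil k B' (⊤ : Ideal A')).comap
      (Algebra.TensorProduct.map f g).toLinearMap := by
    refine Submodule.map₂_le.2 fun a _ n hn => ?_
    have hn' : g n ∈ nilradical B' := (mem_nilradical.1 hn).map g
    simpa [tensorNil] using Submodule.apply_mem_map₂ (TensorProduct.mk k A' B')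
      (p := (⊤ : Ideal A').restrictScalars k) (q := (nilradical B').restrictScalars k)
      (m := f a) trivial hn'
  exact hle hz

theorem isNilpotent_of_mem_tensorNil {M : Ideal A} {z : A ⊗[k] B} (hz : z ∈ tensorNil k B M) :
    IsNilpotent z := by
  have hle : tensorNil k B M ≤ (nilradical (A ⊗[k] B)).restrictScalars k := by
    refine Submodule.map₂_le.2 fun a _ n hn => ?_
    have h1 : IsNilpotent ((1 : A) ⊗ₜ[k] n) :=
      (mem_nilradical.1 hn).map (Algebra.TensorProduct.includeRight : B →ₐ[k] A ⊗[k] B)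
    have h2 : a ⊗ₜ[k] n = (a ⊗ₜ[k] (1 : B)) * ((1 : A) ⊗ₜ[k] n) := by simp
    change a ⊗ₜ[k] n ∈ nilradical (A ⊗[k] B)
    rw [h2]
    exact Ideal.mul_mem_left _ _ h1
  exact hle hz

theorem mem_unitsMulUnits {u : (A ⊗[k] B)ˣ} :
    u ∈ unitsMulUnits k A B ↔ ∃ (a : Aˣ) (b : Bˣ), (u : A ⊗[k] B) = (a : A) ⊗ₜ (b : B) := by
  rw [unitsMulUnits, Subgroup.mem_sup]
  constructor
  · rintro ⟨_, ⟨a, rfl⟩, _, ⟨b, rfl⟩, rfl⟩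
    exact ⟨a, b, by simp⟩
  · rintro ⟨a, b, h⟩
    exact ⟨_, ⟨a, rfl⟩, _, ⟨b, rfl⟩, Units.ext (by simp [h])⟩

theorem summandHom_apply (M : Ideal A) (s : unitsMulUnits k A B × oneAddTensorNil k B M) :
    summandHom k B M s = s.1 * s.2 := rfl

theorem exists_algHom_of_bijective_algebraMap {M : Ideal A}
    (hM : Function.Bijective (algebraMap k (A ⧸ M))) :
    ∃ ε : A →ₐ[k] k, ∀ a, ε a = 0 ↔ a ∈ M := by
  let e := AlgEquiv.ofBijective (Algebra.ofId k (A ⧸ M)) hM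
  refine ⟨e.symm.toAlgHom.comp (Ideal.Quotient.mkₐ k M), fun a => ?_⟩
  rw [← Ideal.Quotient.eq_zero_iff_mem]
  exact map_eq_zero_iff e.symm e.symm.injective

/-- From `A = k ⊕ M`: the tensor `a ⊗ n` is `1 ⊗ ε(a)n` plus `(a - ε(a)) ⊗ n`. -/
theorem exists_add_eq_of_mem_tensorNil_top {M : Ideal A} {ε : A →ₐ[k] k}
    (hε : ∀ a, ε a = 0 ↔ a ∈ M) {z : A ⊗[k] B} (hz : z ∈ tensorNil k B (⊤ : Ideal A)) :
    ∃ n ∈ nilradical B, ∃ y ∈ tensorNil k B M, z = (1 : A) ⊗ₜ n + y := by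
  have hle : tensorNil k B (⊤ : Ideal A) ≤
      ((nilradical B).restrictScalars k).map (TensorProduct.mk k A B 1) ⊔ tensorNil k B M := by
    refine Submodule.map₂_le.2 fun a _ n hn => Submodule.mem_sup.2
      ⟨_, ⟨ε a • n, Submodule.smul_mem _ _ hn, rfl⟩, (a - algebraMap k A (ε a)) ⊗ₜ n,
        Submodule.apply_mem_map₂ (TensorProduct.mk k A B) ((hε _).1 (by simp)) hn, ?_⟩
    simp [TensorProduct.sub_tmul, Algebra.algebraMap_eq_smul_one, TensorProduct.smul_tmul]
  obtain ⟨_, ⟨n, hn, rfl⟩, y, hy, rfl⟩ := Submodule.mem_sup.1 (hle hz)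
  exact ⟨n, hn, y, hy, rfl⟩

/-- Writing `z = 1 ⊗ n + y`, the unit `c = 1 + n` is absorbed into `b`, and dividing by it keeps `y`
in `M ⊗ Nil(B)`. -/
theorem mem_range_summandHom {M : Ideal A} (hM : Function.Bijective (algebraMap k (A ⧸ M)))
    {u : (A ⊗[k] B)ˣ} (a : Aˣ) (b : Bˣ) {z : A ⊗[k] B} (hz : z ∈ tensorNil k B (⊤ : Ideal A))
    (hu : (u : A ⊗[k] B) = ((a : A) ⊗ₜ (b : B)) * (1 + z)) : u ∈ (summandHom k B M).range := by
  obtain ⟨ε, hε⟩ := exists_algHom_of_bijective_algebraMap hM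
  obtain ⟨n, hn, y, hy, rfl⟩ := exists_add_eq_of_mem_tensorNil_top hε hz
  obtain ⟨c, hc⟩ : IsUnit (1 + n) := (mem_nilradical.1 hn).isUnit_one_add
  let s : (A ⊗[k] B)ˣ :=
    Units.map ((Algebra.TensorProduct.includeLeft : A →ₐ[k] A ⊗[k] B) : A →* A ⊗[k] B) a *
      Units.map ((Algebra.TensorProduct.includeRight : B →ₐ[k] A ⊗[k] B) : B →* A ⊗[k] B) (b * c)
  have hs : (s : A ⊗[k] B) = (a : A) ⊗ₜ ((b * c : Bˣ) : B) := by simp [s]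
  have hsu : (u : A ⊗[k] B) = (s : A ⊗[k] B) * (1 + ((1 : A) ⊗ₜ ((c⁻¹ : Bˣ) : B)) * y) := by
    have h1 : (1 : A ⊗[k] B) + ((1 : A) ⊗ₜ n + y) = (1 : A) ⊗ₜ (c : B) + y := by
      rw [hc, TensorProduct.tmul_add, Algebra.TensorProduct.one_def, add_assoc]
    rw [hu, h1, hs, mul_add, mul_add, ← mul_assoc]
    simp
  refine ⟨(⟨s, mem_unitsMulUnits.2 ⟨a, b * c, hs⟩⟩, ⟨s⁻¹ * u, ?_⟩), ?_⟩
  · change ((s⁻¹ * u : (A ⊗[k] B)ˣ) : A ⊗[k] B) - 1 ∈ tensorNil k B M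
    rw [Units.val_mul, hsu, Units.inv_mul_cancel_left, add_sub_cancel_left]
    exact mul_mem_tensorNil k B M _ hy
  · rw [summandHom_apply]
    exact mul_inv_cancel_left s u

/-- Evaluating `a ⊗ b` at `M` gives `ε(a) b = 1`, so the unit is `a' ⊗ 1`. A functional killing
`Nil(B)` but not `1` then forces `a' = 1`. -/
theorem eq_one_of_mem_unitsMulUnits_of_mem_oneAddTensorNil {M : Ideal A}
    (hM : Function.Bijective (algebraMap k (A ⧸ M))) {s : (A ⊗[k] B)ˣ}
    (hs : s ∈ unitsMulUnits k A B) (hs' : s ∈ oneAddTensorNil k B M) : s = 1 := by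
  rcases subsingleton_or_nontrivial B with hB | hB
  · have : Subsingleton (A ⊗[k] B) := subsingleton_of_zero_eq_one <| by
      rw [Algebra.TensorProduct.one_def, Subsingleton.elim (1 : B) 0, TensorProduct.tmul_zero]
    exact Units.ext (Subsingleton.elim _ _)
  obtain ⟨a, b, hab⟩ := mem_unitsMulUnits.1 hs
  obtain ⟨ε, hε⟩ := exists_algHom_of_bijective_algebraMap hM
  have hsub : (s : A ⊗[k] B) - 1 ∈ tensorNil k B M := hs'
  have h1 : tensorNil k B M ≤ LinearMap.ker (sliceLeft ε.toLinearMap) :=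
    Submodule.map₂_le.2 fun m hm n _ => by simp [(hε m).2 hm]
  have hb : ε a • (b : B) = 1 := by
    have := h1 hsub
    rwa [LinearMap.mem_ker, map_sub, sliceLeft_algHom_one, hab, sliceLeft_tmul, sub_eq_zero] at this
  have hεa : ε a ≠ 0 := (a.isUnit.map ε).ne_zero
  have hs1 : (s : A ⊗[k] B) = ((ε a)⁻¹ • (a : A)) ⊗ₜ (1 : B) := by
    rw [hab, ← hb, TensorProduct.tmul_smul, TensorProduct.smul_tmul', smul_smul,
      mul_inv_cancel₀ hεa, one_smul]
  obtain ⟨ψ, hψ, hψN⟩ := Submodule.exists_le_ker_of_notMem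
    (p := (nilradical B).restrictScalars k) (v := (1 : B)) (by
      change ¬ (1 : B) ∈ nilradical B
      rw [mem_nilradical]; exact not_isNilpotent_one)
  have h2 : tensorNil k B M ≤ LinearMap.ker (sliceRight ψ) :=
    Submodule.map₂_le.2 fun m _ n hn => by simp [show ψ n = 0 from hψN hn]
  have h3 := h2 hsub
  rw [LinearMap.mem_ker, map_sub, Algebra.TensorProduct.one_def, hs1, sliceRight_tmul,
    sliceRight_tmul, sub_eq_zero] at h3
  refine Units.ext ?_
  rw [hs1, smul_right_injective A hψ h3, Units.val_one, Algebra.TensorProduct.one_def]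

theorem summandHom_injective {M : Ideal A} (hM : Function.Bijective (algebraMap k (A ⧸ M))) :
    Function.Injective (summandHom k B M) := by
  rw [injective_iff_map_eq_one]
  rintro ⟨⟨s, hs⟩, ⟨t, ht⟩⟩ h
  have h' : s * t = 1 := h
  have hst : s = t⁻¹ := eq_inv_of_mul_eq_one_left h'
  have hs1 : s = 1 := eq_one_of_mem_unitsMulUnits_of_mem_oneAddTensorNil hM hs
    (hst ▸ inv_mem ht)
  subst hs1
  have ht1 : t = 1 := by simpa using h'
  subst ht1
  rfl

end Factorization

/-! ### Connected spectra through idempotents. -/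

section Connected

theorem connectedSpace_primeSpectrum_iff {R : Type*} [CommRing R] :
    ConnectedSpace (PrimeSpectrum R) ↔
      Nontrivial R ∧ ∀ e : R, IsIdempotentElem e → e = 0 ∨ e = 1 := by
  rw [connectedSpace_iff_clopen, PrimeSpectrum.nonempty_iff_nontrivial]
  refine and_congr_right fun _ => ⟨fun h e he => ?_, fun h s hs => ?_⟩
  · rcases h _ (PrimeSpectrum.isClopen_iff.2 ⟨e, he, rfl⟩) with h | h
    · refine Or.inl (PrimeSpectrum.basicOpen_injOn_isIdempotentElem he .zero ?_)
      exact TopologicalSpace.Opens.ext (by simpa using h)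
    · refine Or.inr (PrimeSpectrum.basicOpen_injOn_isIdempotentElem he .one ?_)
      exact TopologicalSpace.Opens.ext (by simpa using h)
  · obtain ⟨e, he, rfl⟩ := PrimeSpectrum.isClopen_iff.1 hs
    rcases h e he with rfl | rfl
    · exact Or.inl (by simp)
    · exact Or.inr (by simp)

/-- This passes connectedness to subalgebras of finite type. -/
theorem connectedSpace_primeSpectrum_of_injective {R S : Type*} [CommRing R] [CommRing S]
    (f : R →+* S) (hf : Function.Injective f) [ConnectedSpace (PrimeSpectrum S)] :
    ConnectedSpace (PrimeSpectrum R) := by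
  obtain ⟨_, h⟩ := connectedSpace_primeSpectrum_iff.1 ‹ConnectedSpace (PrimeSpectrum S)›
  refine connectedSpace_primeSpectrum_iff.2 ⟨f.domain_nontrivial, fun e he => ?_⟩
  refine (h (f e) (he.map f)).imp (fun h => hf (by simpa using h)) fun h => hf (by simpa using h)

theorem connectedSpace_primeSpectrum_quotient_nilradical (R : Type*) [CommRing R]
    [ConnectedSpace (PrimeSpectrum R)] : ConnectedSpace (PrimeSpectrum (R ⧸ nilradical R)) := by
  obtain ⟨_, h⟩ := connectedSpace_primeSpectrum_iff.1 ‹ConnectedSpace (PrimeSpectrum R)›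
  refine connectedSpace_primeSpectrum_iff.2 ⟨Ideal.Quotient.nontrivial_iff.2 ?_, fun e he => ?_⟩
  · rw [Ideal.ne_top_iff_one, mem_nilradical]
    exact not_isNilpotent_one
  · obtain ⟨e', he', rfl⟩ := exists_isIdempotentElem_eq_of_ker_isNilpotent
      (Ideal.Quotient.mk (nilradical R)) (fun x hx => by
        rwa [Ideal.mk_ker, mem_nilradical] at hx) e (Ideal.Quotient.mk_surjective e) he
    exact (h e' he').imp (fun h => by simp [h]) fun h => by simp [h]

end Connected

/-! ### Reduction to finite type. -/

section Descent

variable {k A B : Type*} [Field k] [CommRing A] [CommRing B] [Algebra k A] [Algebra k B]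

/-- Modulo `Nil(B)` the unit is a pure tensor. Units lift along a nil ideal, and the quotient by the
lifted tensor is `1` modulo `A ⊗ Nil(B)`. -/
theorem exists_units_eq_tmul_mul_one_add [IsAlgClosed k] [Algebra.FiniteType k A]
    [Algebra.FiniteType k B] [IsReduced A] [ConnectedSpace (PrimeSpectrum A)]
    [ConnectedSpace (PrimeSpectrum B)] (v : (A ⊗[k] B)ˣ) :
    ∃ (a : Aˣ) (b : Bˣ), ∃ z ∈ tensorNil k B (⊤ : Ideal A),
      (v : A ⊗[k] B) = ((a : A) ⊗ₜ (b : B)) * (1 + z) := by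
  have := connectedSpace_primeSpectrum_quotient_nilradical B
  have := nontrivial_of_connectedSpace_primeSpectrum (B ⧸ nilradical B)
  have : IsReduced (B ⧸ nilradical B) :=
    (Ideal.isRadical_iff_quotient_reduced _).1 (Ideal.radical_isRadical _)
  let π : B →ₐ[k] B ⧸ nilradical B := Ideal.Quotient.mkₐ k _
  let ρ : A ⊗[k] B →ₐ[k] A ⊗[k] (B ⧸ nilradical B) :=
    Algebra.TensorProduct.map (AlgHom.id k A) π
  obtain ⟨a, c, hac⟩ := exists_units_eq_tmul (exists_eq_tmul_of_isReduced
    (Units.map (ρ : A ⊗[k] B →* A ⊗[k] (B ⧸ nilradical B)) v))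
  obtain ⟨b₀, hb₀⟩ := Ideal.Quotient.mk_surjective (c : B ⧸ nilradical B)
  have hbu : IsUnit b₀ := by
    obtain ⟨d, hd⟩ := Ideal.Quotient.mk_surjective ((c⁻¹ : (B ⧸ nilradical B)ˣ) : B ⧸ nilradical B)
    have h1 : IsNilpotent (b₀ * d - 1) := by
      rw [← mem_nilradical, ← Ideal.Quotient.eq_zero_iff_mem]
      simp [hb₀, hd]
    have h2 := h1.isUnit_one_add
    rw [add_sub_cancel] at h2
    exact isUnit_of_mul_isUnit_left h2
  obtain ⟨b, rfl⟩ := hbu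
  let s : (A ⊗[k] B)ˣ :=
    Units.map ((Algebra.TensorProduct.includeLeft : A →ₐ[k] A ⊗[k] B) : A →* A ⊗[k] B) a *
      Units.map ((Algebra.TensorProduct.includeRight : B →ₐ[k] A ⊗[k] B) : B →* A ⊗[k] B) b
  have hs : (s : A ⊗[k] B) = (a : A) ⊗ₜ (b : B) := by simp [s]
  refine ⟨a, b, ((s⁻¹ * v : (A ⊗[k] B)ˣ) : A ⊗[k] B) - 1, ?_, ?_⟩
  · refine mem_tensorNil_top_of_sliceLeft fun φ => ?_
    have hρ : ρ v = ρ s := by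
      rw [hs]
      refine Eq.trans hac ?_
      rw [← hb₀]
      rfl
    have h0 : ρ (((s⁻¹ * v : (A ⊗[k] B)ˣ) : A ⊗[k] B) - 1) = 0 := by
      rw [map_sub, Units.val_mul, map_mul, hρ, ← map_mul, Units.inv_mul, sub_self]
    have h1 := sliceLeft_map (A' := A) π φ (((s⁻¹ * v : (A ⊗[k] B)ˣ) : A ⊗[k] B) - 1)
    rw [show Algebra.TensorProduct.map (AlgHom.id k A) π _ = 0 from h0, map_zero] at h1
    exact Ideal.Quotient.eq_zero_iff_mem.1 h1.symm
  · rw [← hs, add_sub_cancel]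
    exact congrArg Units.val (mul_inv_cancel_left s v).symm

theorem range_map_val_mono {A₁ A₂ : Subalgebra k A} {B₁ B₂ : Subalgebra k B} (hA : A₁ ≤ A₂)
    (hB : B₁ ≤ B₂) : (Algebra.TensorProduct.map A₁.val B₁.val).range ≤
      (Algebra.TensorProduct.map A₂.val B₂.val).range := by
  have h : Algebra.TensorProduct.map A₁.val B₁.val =
      (Algebra.TensorProduct.map A₂.val B₂.val).comp
        (Algebra.TensorProduct.map (Subalgebra.inclusion hA) (Subalgebra.inclusion hB)) := by
    ext <;> simp
  rw [h]
  exact AlgHom.range_comp_le_range _ _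

theorem exists_fg_subalgebras_mem_range (z : A ⊗[k] B) :
    ∃ (A₀ : Subalgebra k A) (B₀ : Subalgebra k B), A₀.FG ∧ B₀.FG ∧
      z ∈ (Algebra.TensorProduct.map A₀.val B₀.val).range := by
  induction z using TensorProduct.induction_on with
  | zero => exact ⟨⊥, ⊥, Subalgebra.fg_bot, Subalgebra.fg_bot, zero_mem _⟩
  | tmul a b =>
    refine ⟨Algebra.adjoin k {a}, Algebra.adjoin k {b}, ⟨{a}, by simp⟩,
      ⟨{b}, by simp⟩,
      ⟨⟨a, Algebra.self_mem_adjoin_singleton k a⟩ ⊗ₜ ⟨b, Algebra.self_mem_adjoin_singleton k b⟩, rfl⟩⟩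
  | add y z hy hz =>
    obtain ⟨A₁, B₁, hA₁, hB₁, hy⟩ := hy
    obtain ⟨A₂, B₂, hA₂, hB₂, hz⟩ := hz
    refine ⟨A₁ ⊔ A₂, B₁ ⊔ B₂, hA₁.sup hA₂, hB₁.sup hB₂, add_mem ?_ ?_⟩
    · exact range_map_val_mono le_sup_left le_sup_left hy
    · exact range_map_val_mono le_sup_right le_sup_right hz

/-- A unit of `A ⊗ B` is defined over subalgebras of finite type. -/
theorem exists_fg_subalgebras_units_map_eq (x : (A ⊗[k] B)ˣ) :
    ∃ (A₀ : Subalgebra k A) (B₀ : Subalgebra k B), A₀.FG ∧ B₀.FG ∧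
      ∃ y : (A₀ ⊗[k] B₀)ˣ, Algebra.TensorProduct.map A₀.val B₀.val (y : A₀ ⊗[k] B₀) = x := by
  obtain ⟨A₁, B₁, hA₁, hB₁, h₁⟩ := exists_fg_subalgebras_mem_range (x : A ⊗[k] B)
  obtain ⟨A₂, B₂, hA₂, hB₂, h₂⟩ :=
    exists_fg_subalgebras_mem_range ((x⁻¹ : (A ⊗[k] B)ˣ) : A ⊗[k] B)
  refine ⟨A₁ ⊔ A₂, B₁ ⊔ B₂, hA₁.sup hA₂, hB₁.sup hB₂, ?_⟩
  obtain ⟨y, hy⟩ := range_map_val_mono le_sup_left le_sup_left h₁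
  obtain ⟨z, hz⟩ := range_map_val_mono le_sup_right le_sup_right h₂
  -- Over a field this map is injective by flatness, so the lifts of `x` and `x⁻¹` are already
  -- mutually inverse.
  have hinj : Function.Injective
      (Algebra.TensorProduct.map (A₁ ⊔ A₂).val (B₁ ⊔ B₂).val) :=
    TensorProduct.map_injective_of_flat_flat (A₁ ⊔ A₂).val.toLinearMap (B₁ ⊔ B₂).val.toLinearMap
      Subtype.val_injective Subtype.val_injective
  refine ⟨Units.mkOfMulEqOne y z (hinj ?_), hy⟩
  rw [map_mul, map_one]
  exact (congrArg₂ (· * ·) hy hz).trans x.mul_inv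

/-- Units coming from algebras of finite type with connected spectrum decompose. -/
theorem mem_range_summandHom_of_map_eq [IsAlgClosed k] {A' B' : Type*} [CommRing A'] [CommRing B']
    [Algebra k A'] [Algebra k B'] [Algebra.FiniteType k A] [Algebra.FiniteType k B] [IsReduced A]
    [ConnectedSpace (PrimeSpectrum A)] [ConnectedSpace (PrimeSpectrum B)] {M : Ideal A'}
    (hM : Function.Bijective (algebraMap k (A' ⧸ M))) (f : A →ₐ[k] A') (g : B →ₐ[k] B')
    (y : (A ⊗[k] B)ˣ) {x : (A' ⊗[k] B')ˣ}
    (hx : Algebra.TensorProduct.map f g (y : A ⊗[k] B) = x) :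
    x ∈ (summandHom k B' M).range := by
  obtain ⟨a, b, z, hz, hy⟩ := exists_units_eq_tmul_mul_one_add y
  refine mem_range_summandHom hM (Units.map (f : A →* A') a) (Units.map (g : B →* B') b)
    (map_mem_tensorNil_top f g hz) ?_
  rw [← hx, hy]
  simp

theorem summandHom_surjective [IsAlgClosed k] [IsReduced A] [ConnectedSpace (PrimeSpectrum A)]
    [ConnectedSpace (PrimeSpectrum B)] {M : Ideal A}
    (hM : Function.Bijective (algebraMap k (A ⧸ M))) :
    Function.Surjective (summandHom k B M) := fun x => by
  obtain ⟨A₀, B₀, hA₀, hB₀, y, hy⟩ := exists_fg_subalgebras_units_map_eq x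
  have := A₀.fg_iff_finiteType.1 hA₀
  have := B₀.fg_iff_finiteType.1 hB₀
  have : IsReduced A₀ := isReduced_of_injective A₀.val Subtype.val_injective
  have := connectedSpace_primeSpectrum_of_injective A₀.val.toRingHom Subtype.val_injective
  have := connectedSpace_primeSpectrum_of_injective B₀.val.toRingHom Subtype.val_injective
  exact mem_range_summandHom_of_map_eq hM A₀.val B₀.val y hy

end Descent

/-! ### Primitive idempotents and decompositions. -/

section Idempotents

variable {R : Type*} [CommRing R]

/-- An idempotent is determined by the primes containing it, hence by the minimal ones: for `q ≤ p`,
it lies in `p` exactly when it lies in `q`. -/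
theorem finite_setOf_isIdempotentElem [IsNoetherianRing R] : {e : R | IsIdempotentElem e}.Finite := by
  have hmem {e : R} (he : IsIdempotentElem e) {p q : Ideal R} (hq : q.IsPrime) (hp : p.IsPrime)
      (hqp : q ≤ p) : e ∈ p ↔ e ∈ q := by
    refine ⟨fun hep => ?_, fun h => hqp h⟩
    by_contra heq
    have h0 : e * (1 - e) ∈ q := by rw [he.mul_one_sub_self]; exact q.zero_mem
    have h1 := hqp ((hq.mem_or_mem h0).resolve_left heq)
    exact hp.ne_top ((Ideal.eq_top_iff_one p).2 (by simpa using p.add_mem hep h1))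
  refine Set.Finite.of_finite_image (f := fun e : R => {p ∈ minimalPrimes R | e ∈ p})
    ((minimalPrimes.finite_of_isNoetherianRing R).finite_subsets.subset ?_) ?_
  · rintro _ ⟨e, -, rfl⟩
    exact Set.sep_subset _ _
  · intro e he f hf hef
    refine PrimeSpectrum.basicOpen_injOn_isIdempotentElem he hf ?_
    ext p
    obtain ⟨q, hq, hqp⟩ := Ideal.exists_minimalPrimes_le (I := ⊥) (J := p.asIdeal) bot_le
    have h1 := Set.ext_iff.1 hef q
    simp only [Set.mem_sep_iff] at h1
    change e ∉ p.asIdeal ↔ f ∉ p.asIdeal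
    rw [hmem he hq.1.1 p.2 hqp, hmem hf hq.1.1 p.2 hqp]
    exact not_congr ⟨fun h => (h1.1 ⟨hq, h⟩).2, fun h => (h1.2 ⟨hq, h⟩).2⟩

/-- A nonzero idempotent that is minimal among nonzero idempotents. -/
structure IsPrimitiveIdempotent (e : R) : Prop where
  idem : IsIdempotentElem e
  ne_zero : e ≠ 0
  eq_zero_or_eq : ∀ f : R, IsIdempotentElem f → f * e = f → f = 0 ∨ f = e

theorem IsIdempotentElem.exists_isPrimitiveIdempotent
    (hR : {e : R | IsIdempotentElem e}.Finite) {e : R} (he : IsIdempotentElem e) (h0 : e ≠ 0) :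
    ∃ f : R, IsPrimitiveIdempotent f ∧ f * e = f := by
  -- Among nonzero idempotents below `e`, one with the fewest idempotents below it is primitive.
  have hfin (f : R) : {g : R | IsIdempotentElem g ∧ g * f = g}.Finite := hR.subset fun g hg => hg.1
  obtain ⟨f, ⟨hf, hf0, hfe⟩, hmin⟩ := Set.exists_min_image
    {f : R | IsIdempotentElem f ∧ f ≠ 0 ∧ f * e = f}
    (fun f => {g : R | IsIdempotentElem g ∧ g * f = g}.ncard)
    (hR.subset fun f hf => hf.1) ⟨e, he, h0, he⟩
  refine ⟨f, ⟨hf, hf0, fun g hg hgf => ?_⟩, hfe⟩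
  by_contra! hne
  refine (hmin g ⟨hg, hne.1, by rw [← hgf, mul_assoc, hfe]⟩).not_gt
    (Set.ncard_lt_ncard ⟨fun x hx => ⟨hx.1, ?_⟩, fun hsub => hne.2 ?_⟩ (hfin f))
  · rw [← hx.2, mul_assoc, hgf]
  · have := (hsub ⟨hf, hf⟩ : IsIdempotentElem f ∧ f * g = f).2
    rw [← this, mul_comm, hgf]

theorem IsPrimitiveIdempotent.mul_eq_zero {e f : R} (he : IsPrimitiveIdempotent e)
    (hf : IsPrimitiveIdempotent f) (hne : e ≠ f) : e * f = 0 := by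
  have hef := he.idem.mul hf.idem
  rcases he.eq_zero_or_eq _ hef (by rw [mul_right_comm, he.idem]) with h | h
  · exact h
  · rcases hf.eq_zero_or_eq _ hef (by rw [mul_assoc, hf.idem]) with h' | h'
    · exact h'
    · exact absurd (h.symm.trans h') hne

theorem exists_completeOrthogonalIdempotents_isPrimitiveIdempotent
    (hR : {e : R | IsIdempotentElem e}.Finite) :
    ∃ (n : ℕ) (e : Fin n → R), CompleteOrthogonalIdempotents e ∧
      ∀ i, IsPrimitiveIdempotent (e i) := by
  classical
  have hfin : {e : R | IsPrimitiveIdempotent e}.Finite := hR.subset fun e he => he.idem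
  have := hfin.to_subtype
  have := Fintype.ofFinite {e : R | IsPrimitiveIdempotent e}
  let σ := (Fintype.equivFin {e : R | IsPrimitiveIdempotent e}).symm
  let e : Fin (Fintype.card {e : R | IsPrimitiveIdempotent e}) → R := fun i => σ i
  have hprim (i) : IsPrimitiveIdempotent (e i) := (σ i).2
  have horth : OrthogonalIdempotents e :=
    ⟨fun i => (hprim i).idem, fun i j hij => (hprim i).mul_eq_zero (hprim j) fun h =>
      hij (σ.injective (Subtype.ext h))⟩
  refine ⟨_, e, ⟨horth, ?_⟩, hprim⟩
  -- Otherwise `1 - ∑ e i` dominates a primitive idempotent. It is some `e i`, yet orthogonal to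
  -- itself.
  by_contra hne
  have hsum : IsIdempotentElem (∑ i, e i) := horth.isIdempotentElem_sum
  obtain ⟨f, hf, hfe⟩ := hsum.one_sub.exists_isPrimitiveIdempotent hR
    (sub_ne_zero.2 (Ne.symm hne))
  obtain ⟨i, hi⟩ := σ.surjective ⟨f, hf⟩
  have hfi : e i = f := congrArg Subtype.val hi
  refine hf.ne_zero ?_
  rw [← hfe, ← hfi, mul_sub, mul_one, horth.mul_sum_of_mem (Finset.mem_univ i), sub_self]

theorem nontrivial_quotient_span_one_sub {e : R} (he : IsIdempotentElem e) (h0 : e ≠ 0) :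
    Nontrivial (R ⧸ Ideal.span {1 - e}) := by
  rw [Ideal.Quotient.nontrivial_iff, Ideal.ne_top_iff_one, Ideal.mem_span_singleton]
  rintro ⟨c, hc⟩
  refine h0 ?_
  rw [← mul_one e, hc, ← mul_assoc, he.mul_one_sub_self, zero_mul]

/-- The quotient is the factor `Re`: an idempotent class of `b` is represented by the idempotent `b
* e` of `R`, which lies below `e`. -/
theorem IsPrimitiveIdempotent.connectedSpace {e : R} (he : IsPrimitiveIdempotent e) :
    ConnectedSpace (PrimeSpectrum (R ⧸ Ideal.span {1 - e})) := by
  refine connectedSpace_primeSpectrum_iff.2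
    ⟨nontrivial_quotient_span_one_sub he.idem he.ne_zero, fun x hx => ?_⟩
  obtain ⟨b, rfl⟩ := Ideal.Quotient.mk_surjective x
  have he1 : Ideal.Quotient.mk (Ideal.span {1 - e}) e = 1 := by
    rw [eq_comm, ← map_one (Ideal.Quotient.mk (Ideal.span {1 - e})), Ideal.Quotient.eq]
    exact Ideal.mem_span_singleton_self _
  have hb : Ideal.Quotient.mk (Ideal.span {1 - e}) (b * e) = Ideal.Quotient.mk _ b := by
    rw [map_mul, he1, mul_one]
  have hidem : IsIdempotentElem (b * e) := by
    obtain ⟨c, hc⟩ := Ideal.mem_span_singleton.1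
      (Ideal.Quotient.eq.1 ((map_mul _ b b).trans hx.eq))
    have h1 : b * e * (b * e) - b * e = (b * b - b) * e + b * b * (e * e - e) := by ring
    have h2 : (1 - e) * c * e = c * (e - e * e) := by ring
    refine sub_eq_zero.1 ?_
    rw [h1, hc, h2, he.idem.eq]
    ring
  rw [← hb]
  rcases he.eq_zero_or_eq _ hidem (by rw [mul_assoc, he.idem]) with h | h
  · exact Or.inl (by rw [h, map_zero])
  · exact Or.inr (by rw [h, he1])

/-- The decomposition of an algebra given by complete orthogonal idempotents. -/
noncomputable def CompleteOrthogonalIdempotents.algEquivPi (k : Type*) {B : Type*} [Field k]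
    [CommRing B] [Algebra k B] {n : ℕ} {e : Fin n → B} (he : CompleteOrthogonalIdempotents e) :
    B ≃ₐ[k] ∀ i, B ⧸ Ideal.span {1 - e i} :=
  AlgEquiv.ofBijective (AlgHom.pi fun i => Ideal.Quotient.mkₐ k (Ideal.span {1 - e i}))
    he.bijective_pi

end Idempotents

/-! ### The subgroups attached to decompositions. -/

section Decomposition

variable {k A B : Type*} [Field k] [CommRing A] [CommRing B] [Algebra k A] [Algebra k B] {n : ℕ}
  {C : Fin n → Type*} [∀ i, CommRing (C i)] [∀ i, Algebra k (C i)]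

theorem val_unitsTensorPi_apply (e : B ≃ₐ[k] ∀ i, C i) (x : (A ⊗[k] B)ˣ) (i : Fin n) :
    ((unitsTensorPi A e x i : (A ⊗[k] C i)ˣ) : A ⊗[k] C i) =
      Algebra.TensorProduct.map (AlgHom.id k A) ((Pi.evalAlgHom k C i).comp e.toAlgHom)
        (x : A ⊗[k] B) := by
  have key (z : A ⊗[k] B) : Algebra.TensorProduct.piRight k k A C
      (Algebra.TensorProduct.congr (AlgEquiv.refl : A ≃ₐ[k] A) e z) i =
      Algebra.TensorProduct.map (AlgHom.id k A) ((Pi.evalAlgHom k C i).comp e.toAlgHom) z := by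
    induction z using TensorProduct.induction_on with
    | zero => simp
    | add y z hy hz => simp only [map_add, Pi.add_apply, hy, hz]
    | tmul a b => simp
  exact key x

theorem muHom_injective {M : Ideal A} (hM : Function.Bijective (algebraMap k (A ⧸ M)))
    (e : B ≃ₐ[k] ∀ i, C i) : Function.Injective (muHom M e) :=
  (unitsTensorPi A e).symm.injective.comp fun _ _ h =>
    funext fun i => summandHom_injective hM (congrFun h i)

theorem mem_muSubgroup {M : Ideal A} (e : B ≃ₐ[k] ∀ i, C i) {x : (A ⊗[k] B)ˣ}
    (h : ∀ i, unitsTensorPi A e x i ∈ (summandHom k (C i) M).range) : x ∈ muSubgroup M e := by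
  choose s hs using h
  exact ⟨s, (MulEquiv.symm_apply_eq _).2 (funext hs)⟩

end Decomposition

/-- `B` may have infinitely many idempotents, so it is cut by the primitive idempotents of a finite
type subalgebra `B₀` over which `x` is defined. The factors of `B` need not be connected; those of
`B₀` are, and the factorization is transported from them. -/
theorem exists_decomposition_mem_muSubgroup {k : Type u} {A : Type v} {B : Type w} [Field k]
    [IsAlgClosed k] [CommRing A] [CommRing B] [Algebra k A] [Algebra k B] [IsReduced A]
    [ConnectedSpace (PrimeSpectrum A)] {M : Ideal A}
    (hM : Function.Bijective (algebraMap k (A ⧸ M))) (x : (A ⊗[k] B)ˣ) :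
    ∃ (n : ℕ) (C : Fin n → Type w) (_ : ∀ i, CommRing (C i)) (_ : ∀ i, Algebra k (C i))
      (e : B ≃ₐ[k] ∀ i, C i), (∀ i, Nontrivial (C i)) ∧ x ∈ muSubgroup M e := by
  obtain ⟨A₀, B₀, hA₀, hB₀, y, hy⟩ := exists_fg_subalgebras_units_map_eq x
  have := A₀.fg_iff_finiteType.1 hA₀
  have := B₀.fg_iff_finiteType.1 hB₀
  have := Algebra.FiniteType.isNoetherianRing k B₀
  have : IsReduced A₀ := isReduced_of_injective A₀.val Subtype.val_injective
  have := connectedSpace_primeSpectrum_of_injective A₀.val.toRingHom Subtype.val_injective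
  obtain ⟨n, e₀, he₀, hprim⟩ := exists_completeOrthogonalIdempotents_isPrimitiveIdempotent
    (finite_setOf_isIdempotentElem (R := B₀))
  have he : CompleteOrthogonalIdempotents fun i => (e₀ i : B) := he₀.map B₀.val.toRingHom
  refine ⟨n, fun i => B ⧸ Ideal.span {1 - (e₀ i : B)}, inferInstance, inferInstance,
    he.algEquivPi k, fun i => nontrivial_quotient_span_one_sub (he.idem i) fun h =>
      (hprim i).ne_zero (Subtype.ext h), mem_muSubgroup _ fun i => ?_⟩
  have := (hprim i).connectedSpace
  let g : B₀ ⧸ Ideal.span {1 - e₀ i} →ₐ[k] B ⧸ Ideal.span {1 - (e₀ i : B)} :=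
    Ideal.quotientMapₐ _ B₀.val (by
      rw [Ideal.span_singleton_le_iff_mem, Ideal.mem_comap]
      exact Ideal.mem_span_singleton_self (1 - (e₀ i : B)))
  let ρ : A₀ ⊗[k] B₀ →ₐ[k] A₀ ⊗[k] (B₀ ⧸ Ideal.span {1 - e₀ i}) :=
    Algebra.TensorProduct.map (AlgHom.id k A₀) (Ideal.Quotient.mkₐ k _)
  refine mem_range_summandHom_of_map_eq hM A₀.val g
    (Units.map ρ.toRingHom.toMonoidHom y) ?_
  rw [val_unitsTensorPi_apply, ← hy]
  have key : (Algebra.TensorProduct.map A₀.val g).comp ρ =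
      (Algebra.TensorProduct.map (AlgHom.id k A) ((Pi.evalAlgHom k _ i).comp
        (he.algEquivPi k).toAlgHom)).comp (Algebra.TensorProduct.map A₀.val B₀.val) := by
    apply Algebra.TensorProduct.ext'
    intro a b
    rfl
  exact DFunLike.congr_fun key (y : A₀ ⊗[k] B₀)

theorem mainTheorem7 (k : Type u) (A : Type v) (B : Type w)
    [Field k] [IsAlgClosed k] [CommRing A] [CommRing B] [Algebra k A] [Algebra k B]
    [IsReduced A] [ConnectedSpace (PrimeSpectrum A)]
    (M : Ideal A) [M.IsMaximal] (hM : Function.Bijective (algebraMap k (A ⧸ M))) :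
    -- every decomposition gives a subgroup which is the stated direct sum
    (∀ (n : ℕ) (C : Fin n → Type w) [∀ i, CommRing (C i)] [∀ i, Algebra k (C i)]
        (e : B ≃ₐ[k] ∀ i, C i),
      (∀ i, ∀ x ∈ tensorNil k (C i) M, IsUnit (1 + x)) ∧
      Function.Injective (muHom M e)) ∧
    -- every unit lies in such a subgroup
    (∀ x : (A ⊗[k] B)ˣ,
      ∃ (n : ℕ) (C : Fin n → Type w) (_ : ∀ i, CommRing (C i)) (_ : ∀ i, Algebra k (C i))
        (e : B ≃ₐ[k] ∀ i, C i), (∀ i, Nontrivial (C i)) ∧ x ∈ muSubgroup M e) ∧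
    -- finitely many idempotents: a decomposition into connected factors exists
    ({b : B | IsIdempotentElem b}.Finite →
      ∃ (n : ℕ) (C : Fin n → Type w) (_ : ∀ i, CommRing (C i)) (_ : ∀ i, Algebra k (C i))
        (_ : B ≃ₐ[k] ∀ i, C i), ∀ i, ConnectedSpace (PrimeSpectrum (C i))) ∧
    (IsNoetherianRing B → {b : B | IsIdempotentElem b}.Finite) ∧
    -- for every decomposition into connected factors the subgroup is everything
    (∀ (n : ℕ) (C : Fin n → Type w) [∀ i, CommRing (C i)] [∀ i, Algebra k (C i)]
        (e : B ≃ₐ[k] ∀ i, C i),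
      (∀ i, ConnectedSpace (PrimeSpectrum (C i))) → muSubgroup M e = ⊤) ∧
    -- the case of a connected ring
    (ConnectedSpace (PrimeSpectrum B) → Function.Bijective (summandHom k B M)) := by
  refine ⟨fun n C _ _ e => ⟨fun i x hx => (isNilpotent_of_mem_tensorNil hx).isUnit_one_add,
    muHom_injective hM e⟩, exists_decomposition_mem_muSubgroup hM, fun hB => ?_,
    fun _ => finite_setOf_isIdempotentElem, fun n C _ _ e hC => ?_,
    fun _ => ⟨summandHom_injective hM, summandHom_surjective hM⟩⟩
  · obtain ⟨n, e, he, hprim⟩ := exists_completeOrthogonalIdempotents_isPrimitiveIdempotent hB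
    exact ⟨n, fun i => B ⧸ Ideal.span {1 - e i}, inferInstance, inferInstance, he.algEquivPi k,
      fun i => (hprim i).connectedSpace⟩
  · refine eq_top_iff.2 fun x _ => mem_muSubgroup e fun i => ?_
    have := hC i
    exact summandHom_surjective hM _
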